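/- A 0-1 matrix $A$ contains a 0-1 matrix $P$ if some submatrix of $A$ (obtained by deleting rows and columns, keeping the order of the remaining ones) equals $P$ or can be turned into $P$ by changing some ones to zeroes; otherwise $A$ avoids $P$. Let $\mathrm{ex}(n,P)$ be the maximum number of ones in an $n\times n$ 0-1 matrix that avoids $P$ (taken to be $0$ if no such matrix exists). A 0-1 matrix $M$ is called minimally non-linear if $\mathrm{ex}(n,M)=\omega(n)$, that is, $\mathrm{ex}(n,M)/n\to\infty$ as $n\to\infty$, but $\mathrm{ex}(n,P')=O(n)$ for every 0-1 matrix $P'$, of any dimensions, that is contained in $M$ and is not equal to $M$. Lemma. No row of a minimally non-linear 0-1 matrix contains more than six ones. -/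

import Mathlib

open Filter Asymptotics

/-- An `m × n` zero-one matrix; the entry `true` is a one and `false` is a zero.
Rows are numbered from top to bottom and columns from left to right. -/
abbrev ZeroOneMatrix (m n : ℕ) : Type := Matrix (Fin m) (Fin n) Bool

namespace ZeroOneMatrix

/-- `A.Contains P`: some submatrix of `A` (an order-preserving choice `f` of rows and `g` of
columns) equals `P` or can be turned into `P` by changing some ones to zeroes. -/
def Contains {m n k l : ℕ} (A : ZeroOneMatrix m n) (P : ZeroOneMatrix k l) : Prop :=
  ∃ (f : Fin k → Fin m) (g : Fin l → Fin n), StrictMono f ∧ StrictMono g ∧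
    ∀ i j, P i j = true → A (f i) (g j) = true

/-- `A` avoids `P`. -/
def Avoids {m n k l : ℕ} (A : ZeroOneMatrix m n) (P : ZeroOneMatrix k l) : Prop :=
  ¬ A.Contains P

/-- The number of ones in row `i`. -/
def rowOnes {m n : ℕ} (A : ZeroOneMatrix m n) (i : Fin m) : ℕ :=
  (Finset.univ.filter fun j : Fin n => A i j = true).card

/-- The number of ones of the matrix. -/
def ones {m n : ℕ} (A : ZeroOneMatrix m n) : ℕ :=
  ∑ i, A.rowOnes i

open Classical in
/-- The extremal function: the maximum number of ones in an `n × n` zero-one matrix that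
avoids `P` (and `0` if there is no such matrix, as happens for large `n` when `P` has no ones). -/
noncomputable def ex {k l : ℕ} (n : ℕ) (P : ZeroOneMatrix k l) : ℕ :=
  (Finset.univ.filter fun A : ZeroOneMatrix n n => A.Avoids P).sup ones

/-- `P` is minimally non-linear: `ex(n, P) = ω(n)`, but `ex(n, P') = O(n)` for every zero-one
matrix `P'`, of any dimensions, that is contained in `P` and is not equal to `P`. -/
def MinimallyNonlinear {k l : ℕ} (P : ZeroOneMatrix k l) : Prop :=
  ((fun n : ℕ => (n : ℝ)) =o[atTop] fun n : ℕ => (ex n P : ℝ)) ∧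
  ∀ (k' l' : ℕ) (P' : ZeroOneMatrix k' l'), P.Contains P' →
    (⟨k', l', P'⟩ : Σ a b : ℕ, ZeroOneMatrix a b) ≠ ⟨k, l, P⟩ →
    (fun n : ℕ => (ex n P' : ℝ)) =O[atTop] fun n : ℕ => (n : ℝ)

end ZeroOneMatrix

/-! Let a row have seven ones, in columns c₀ < … < c₆. Each of the intervals (c₀, c₂), (c₂, c₄),
(c₄, c₆) contains a one of another row: otherwise deleting the middle one would lower the extremal
function by at most a constant factor (`ex_le_of_between`), against minimality. Two of the three
ones found lie on the same side of the row. With three ones of the row they form a proper subpattern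
which, up to reflection, is avoided by square matrices with arbitrarily many ones in every row
(`exists_spreadFree`). So that subpattern is not linear, again against minimality.

These matrices come from a recursion of Ackermann type. `compose` puts a copy of `L` behind each
live column of `G` and gives each row of `G` one new one, in a live column of the copy; so `G` must
have as many rows per group as `L` has live columns. Ones per row grow by one over `G`, rows per
group by one over `L`. The condition `gap` keeps live columns, where the new material goes, away
from the place of y in the forbidden pattern; `group` handles outer rows that share a copy. -/

/-- `Before ℓ s a t`: the row `(ℓ, s)` precedes the row `(a, t)`. Rows are grouped by their live
column, and the groups are ordered from right to left. -/
def Before {C : Type} [LinearOrder C] (ℓ : C) (s : ℕ) (a : C) (t : ℕ) : Prop :=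
  a < ℓ ∨ (a = ℓ ∧ s < t)

theorem Before.le {C : Type} [LinearOrder C] {ℓ a : C} {s t : ℕ} (h : Before ℓ s a t) :
    a ≤ ℓ := by
  rcases h with h | h
  · exact h.le
  · exact h.1.le

/-- A configuration of ones in which each row `(ℓ, s)`, with `ℓ` a live column and `s < m`, has its
last one in column `ℓ` and has at least `k` ones. Condition `spread` says that the pattern with ones
in columns `1, 3, 5` of a top row, and two further ones in columns `2` and `4` of lower rows, the
first one not lower than the second, is avoided. The conditions `group` and `gap` make the
inductive construction of such configurations work. -/
structure LiveSystem (C : Type) [LinearOrder C] (k m : ℕ) where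
  cols : Finset C
  live : Finset C
  A : C → ℕ → C → Prop
  mem_live : ∀ {ℓ s c}, A ℓ s c → ℓ ∈ live
  lt_size : ∀ {ℓ s c}, A ℓ s c → s < m
  mem_cols : ∀ {ℓ s c}, A ℓ s c → c ∈ cols
  lead : ∀ {ℓ s}, ℓ ∈ live → s < m → A ℓ s ℓ
  le_lead : ∀ {ℓ s c}, A ℓ s c → c ≤ ℓ
  live_subset : live ⊆ cols
  live_only : ∀ {ℓ s h}, A ℓ s h → h ∈ live → h = ℓ
  group : ∀ {ℓ s t c₁ x c₂}, s < t → A ℓ s c₁ → A ℓ s c₂ → A ℓ t x → c₁ < x → x < c₂ → False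
  gap : ∀ {r s a t c₁ x c₂ h c₃}, Before r s a t → A r s c₁ → A r s c₂ → A r s c₃ → A a t x →
    h ∈ live → h ≤ a → c₁ < x → x < c₂ → c₂ < h → h < c₃ → False
  spread : ∀ {r s a t b u c₁ x c₂ y c₃}, Before r s a t → (Before a t b u ∨ (b = a ∧ u = t)) →
    A r s c₁ → A r s c₂ → A r s c₃ → A a t x → A b u y →
    c₁ < x → x < c₂ → c₂ < y → y < c₃ → False
  degree : ∀ {ℓ s}, ℓ ∈ live → s < m → ∃ F : Finset C, k ≤ F.card ∧ ∀ c ∈ F, A ℓ s c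

namespace LiveSystem

/-- One live column, and `m` rows with a single one. -/
def single (m : ℕ) : LiveSystem ℕ 1 m where
  cols := {0}
  live := {0}
  A ℓ s c := ℓ = 0 ∧ s < m ∧ c = 0
  mem_live h := by simp [h.1]
  lt_size h := h.2.1
  mem_cols h := by simp [h.2.2]
  lead h hs := by simp_all
  le_lead h := by simp [h.1, h.2.2]
  live_subset := subset_rfl
  live_only h _ := by rw [h.1, h.2.2]
  group _ h₁ h₂ h₃ h₄ h₅ := by omega
  gap _ h₁ _ _ h₂ _ _ h₃ _ _ _ := by omega
  spread _ _ h₁ _ _ h₂ _ h₃ _ _ _ := by omega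
  degree {ℓ s} h hs := ⟨{0}, by simp, by simp_all⟩

/-- `q` live columns and no rows. -/
def empty (k q : ℕ) : LiveSystem ℕ k 0 where
  cols := Finset.range q
  live := Finset.range q
  A _ _ _ := False
  mem_live h := h.elim
  lt_size h := h.elim
  mem_cols h := h.elim
  lead _ h := by omega
  le_lead h := h.elim
  live_subset := subset_rfl
  live_only h := h.elim
  group _ h := h.elim
  gap _ h := h.elim
  spread _ _ h := h.elim
  degree _ h := by omega

/-! ### Composition of live systems -/

/-- The column of a composite system that comes from a column of the outer system. -/
def outer {C : Type} (D : Type) (c : C) : C ×ₗ WithBot D := toLex (c, ⊥)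

/-- The `j`-th column of the copy of the inner system inserted to the right of column `g`. -/
def inner {C D : Type} (g : C) (j : D) : C ×ₗ WithBot D := toLex (g, (j : WithBot D))

theorem inner_inj {C D : Type} {g g' : C} {j j' : D} : inner g j = inner g' j' ↔ g = g' ∧ j = j' := by
  simp [inner]

theorem outer_inj {C D : Type} {c c' : C} : outer D c = outer D c' ↔ c = c' := by
  simp [outer]

theorem inner_ne_outer {C D : Type} {c g : C} {j : D} : inner g j ≠ outer D c := by
  simp [inner, outer]

theorem outer_ne_inner {C D : Type} {c g : C} {j : D} : outer D c ≠ inner g j := by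
  simp [inner, outer]

variable {C D : Type} [LinearOrder C] [LinearOrder D] {k m : ℕ}

theorem outer_lt_outer {c c' : C} : outer D c < outer D c' ↔ c < c' := by
  simp [outer, Prod.Lex.toLex_lt_toLex]

theorem outer_lt_inner {c g : C} {j : D} : outer D c < inner g j ↔ c ≤ g := by
  simp [outer, inner, Prod.Lex.toLex_lt_toLex, le_iff_lt_or_eq]

theorem inner_lt_outer {c g : C} {j : D} : inner g j < outer D c ↔ g < c := by
  simp [outer, inner, Prod.Lex.toLex_lt_toLex]

theorem inner_lt_inner {g g' : C} {j j' : D} :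
    inner g j < inner g' j' ↔ g < g' ∨ (g = g' ∧ j < j') := by
  simp [inner, Prod.Lex.toLex_lt_toLex]

theorem inner_le_inner {g g' : C} {j j' : D} :
    inner g j ≤ inner g' j' ↔ g < g' ∨ (g = g' ∧ j ≤ j') := by
  simp [inner, Prod.Lex.toLex_le_toLex]

/-- The number of live columns to the right of `i`. -/
def rank (L : LiveSystem D k m) (i : D) : ℕ := (L.live.filter (i < ·)).card

theorem rank_lt_card (L : LiveSystem D k m) {i : D} (hi : i ∈ L.live) :
    L.rank i < L.live.card :=
  Finset.card_lt_card (Finset.filter_ssubset.2 ⟨i, hi, lt_irrefl i⟩)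

theorem rank_lt_rank (L : LiveSystem D k m) {i j : D} (hj : j ∈ L.live) (h : i < j) :
    L.rank j < L.rank i := by
  refine Finset.card_lt_card ?_
  refine Finset.ssubset_iff_of_subset (fun x hx => ?_) |>.2 ⟨j, ?_, ?_⟩
  · simp only [Finset.mem_filter] at hx ⊢
    exact ⟨hx.1, h.trans hx.2⟩
  · simp [hj, h]
  · simp

section compose

variable (L : LiveSystem D (k + 1) m) (G : LiveSystem C k L.live.card)

/-- The incidences of the composite system. -/
def composeA (ℓ : C ×ₗ WithBot D) (s : ℕ) (c : C ×ₗ WithBot D) : Prop :=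
  ∃ g i, ℓ = inner g i ∧ g ∈ G.live ∧ i ∈ L.live ∧
    ((∃ j, c = inner g j ∧ L.A i s j) ∨
      (s = m ∧ ((∃ c₀, c = outer D c₀ ∧ G.A g (L.rank i) c₀) ∨ c = inner g i)))

variable {L G}

theorem composeA_inner {g : C} {i : D} {s : ℕ} {c : C ×ₗ WithBot D}
    (h : composeA L G (inner g i) s c) :
    g ∈ G.live ∧ i ∈ L.live ∧ ((s < m ∧ ∃ j, c = inner g j ∧ L.A i s j) ∨
      (s = m ∧ ((∃ c₀, c = outer D c₀ ∧ G.A g (L.rank i) c₀) ∨ c = inner g i))) := by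
  obtain ⟨g', i', h₁, hg, hi, h⟩ := h
  obtain ⟨rfl, rfl⟩ := inner_inj.1 h₁
  refine ⟨hg, hi, ?_⟩
  rcases h with ⟨j, h, h'⟩ | h
  · exact Or.inl ⟨L.lt_size h', j, h, h'⟩
  · exact Or.inr h

theorem composeA_le {ℓ : C ×ₗ WithBot D} {s : ℕ} {c : C ×ₗ WithBot D}
    (h : composeA L G ℓ s c) : c ≤ ℓ := by
  obtain ⟨g, i, rfl, hg, hi, ⟨j, rfl, h⟩ | ⟨-, ⟨c₀, rfl, h⟩ | rfl⟩⟩ := h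
  · exact inner_le_inner.2 (Or.inr ⟨rfl, L.le_lead h⟩)
  · exact (outer_lt_inner.2 (G.le_lead h)).le
  · exact le_rfl

theorem composeA_local {g : C} {i : D} {s : ℕ} {c : C ×ₗ WithBot D}
    (h : composeA L G (inner g i) s c) (hs : s < m) : ∃ j, c = inner g j ∧ L.A i s j := by
  rcases (composeA_inner h).2.2 with h | h
  · exact h.2
  · omega

/-- A one of a row that comes from the outer system lies over a one of the outer system. -/
theorem composeA_global {g : C} {i : D} {c : C ×ₗ WithBot D}
    (h : composeA L G (inner g i) m c) :
    (∃ c₀, c = outer D c₀ ∧ G.A g (L.rank i) c₀) ∨ (c = inner g i ∧ G.A g (L.rank i) g) := by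
  obtain ⟨hg, hi, h | h⟩ := composeA_inner h
  · omega
  · rcases h.2 with h | h
    · exact Or.inl h
    · exact Or.inr ⟨h, G.lead hg (L.rank_lt_card hi)⟩

/-- `rank` counts live columns from the right, the direction in which `Before` orders groups, so the
rows of one outer group keep their order. -/
theorem before_global {g g' : C} {i i' : D} (hi : i ∈ L.live)
    (h : Before (inner g i) m (inner g' i') m) : Before g (L.rank i) g' (L.rank i') := by
  rcases h with h | h
  · rcases inner_lt_inner.1 h with h' | ⟨rfl, h'⟩
    · exact Or.inl h'
    · exact Or.inr ⟨rfl, L.rank_lt_rank hi h'⟩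
  · omega

theorem before_local {g : C} {i i' : D} {s t : ℕ}
    (h : Before (inner g i) s (inner g i') t) : Before i s i' t := by
  rcases h with h | h
  · rcases inner_lt_inner.1 h with h | ⟨-, h⟩
    · exact absurd h (lt_irrefl _)
    · exact Or.inl h
  · exact Or.inr ⟨(inner_inj.1 h.1).2, h.2⟩

theorem eq_inner_of_between {g : C} {j₁ j₂ : D} {c : C ×ₗ WithBot D}
    (h₁ : inner g j₁ < c) (h₂ : c < inner g j₂) : ∃ j, c = inner g j ∧ j₁ < j ∧ j < j₂ := by
  obtain ⟨⟨c, d⟩, rfl⟩ := toLex.surjective c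
  induction d using WithBot.recBotCoe with
  | bot =>
    change inner g j₁ < outer D c at h₁
    change outer D c < inner g j₂ at h₂
    exact absurd (inner_lt_outer.1 h₁) (outer_lt_inner.1 h₂).not_gt
  | coe d =>
    change inner g j₁ < inner c d at h₁
    change inner c d < inner g j₂ at h₂
    rcases inner_lt_inner.1 h₁ with h | ⟨rfl, h⟩ <;>
      rcases inner_lt_inner.1 h₂ with h' | ⟨h'', h'⟩
    · exact absurd h h'.not_gt
    · exact absurd h (h''.le.not_gt)
    · exact absurd h' (lt_irrefl _)
    · exact ⟨d, rfl, h, h'⟩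

theorem compose_group {ℓ c₁ x c₂ : C ×ₗ WithBot D} {s t : ℕ} (hst : s < t)
    (h₁ : composeA L G ℓ s c₁) (h₂ : composeA L G ℓ s c₂) (hx : composeA L G ℓ t x)
    (h₁x : c₁ < x) (hx₂ : x < c₂) : False := by
  obtain ⟨g, i, rfl, -⟩ := id hx
  have ht : t ≤ m := by
    rcases (composeA_inner hx).2.2 with h | h <;> omega
  obtain ⟨j₁, rfl, H₁⟩ := composeA_local h₁ (by omega)
  obtain ⟨j₂, rfl, H₂⟩ := composeA_local h₂ (by omega)
  obtain ⟨j, rfl, H₁x, Hx₂⟩ := eq_inner_of_between h₁x hx₂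
  rcases ht.lt_or_eq with ht | rfl
  · obtain ⟨j', e, Hx⟩ := composeA_local hx ht
    obtain ⟨-, rfl⟩ := inner_inj.1 e
    exact L.group hst H₁ H₂ Hx H₁x Hx₂
  · rcases composeA_global hx with ⟨c, e, -⟩ | ⟨e, -⟩
    · exact inner_ne_outer e
    · obtain ⟨-, rfl⟩ := inner_inj.1 e
      exact (L.le_lead H₂).not_gt Hx₂

theorem compose_live_only {ℓ : C ×ₗ WithBot D} {s : ℕ} {h : C} {i : D}
    (hA : composeA L G ℓ s (inner h i)) (hi : i ∈ L.live) : inner h i = ℓ := by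
  obtain ⟨g, i', rfl, -, -, ⟨j, e, hj⟩ | ⟨-, ⟨c, e, -⟩ | e⟩⟩ := hA
  · obtain ⟨rfl, rfl⟩ := inner_inj.1 e
    rw [L.live_only hj hi]
  · exact absurd e inner_ne_outer
  · exact e

/-- The facts about a row from the outer system with three ones, and a one of a lower row between
the first two of them, that are common to the proofs of `gap` and `spread`. -/
theorem compose_global {g : C} {i : D} {a c₁ x c₂ y c₃ : C ×ₗ WithBot D} {t : ℕ}
    (hb : Before (inner g i) m a t)
    (h₁ : composeA L G (inner g i) m c₁) (h₂ : composeA L G (inner g i) m c₂)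
    (h₃ : composeA L G (inner g i) m c₃) (hx : composeA L G a t x) (hya : y ≤ a)
    (h₁x : c₁ < x) (hx₂ : x < c₂) (h₂y : c₂ < y) (hy₃ : y < c₃) :
    ∃ g' i' γ₁ ξ γ₂ γ₃, a = inner g' i' ∧ Before g (L.rank i) g' (L.rank i') ∧
      G.A g (L.rank i) γ₁ ∧ G.A g (L.rank i) γ₂ ∧ G.A g (L.rank i) γ₃ ∧
      G.A g' (L.rank i') ξ ∧ γ₁ < ξ ∧ ξ < γ₂ ∧ c₂ = outer D γ₂ ∧ g' ≠ g ∧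
      (c₃ = outer D γ₃ ∨ (c₃ = inner g i ∧ γ₃ = g)) := by
  have hi := (composeA_inner h₁).2.1
  -- The only one of this row in an inner column is its last, so `c₁` and `c₂`, having ones to their
  -- right, are outer columns.
  have h₃ℓ := composeA_le h₃
  obtain ⟨γ₂, rfl, H₂⟩ := (composeA_global h₂).resolve_right
    fun h => (h₂y.trans (hy₃.trans_le h₃ℓ)).ne h.1
  obtain ⟨γ₁, rfl, H₁⟩ := (composeA_global h₁).resolve_right
    fun h => (h₁x.trans (hx₂.trans (h₂y.trans (hy₃.trans_le h₃ℓ)))).ne h.1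
  obtain ⟨g', i', rfl, -⟩ := id hx
  -- A row with `t < m` stays inside the copy behind `g'`; then `x < c₂` puts this whole copy left
  -- of `c₂`, while `c₂ < y ≤ a`.
  have htm : t = m := by
    rcases (composeA_inner hx).2.2 with ⟨ht, j, rfl, -⟩ | h
    · have := inner_lt_outer.1 hx₂
      exact absurd this (outer_lt_inner.1 (h₂y.trans_le hya)).not_gt
    · exact h.1
  subst htm
  obtain ⟨ξ, rfl, Hx⟩ := (composeA_global hx).resolve_right
    fun h => (hx₂.trans (h₂y.trans_le hya)).ne h.1
  have hb' := before_global hi hb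
  have H₁x := outer_lt_outer.1 h₁x
  have Hx₂ := outer_lt_outer.1 hx₂
  have hne : g' ≠ g := by
    rintro rfl
    rcases hb' with h | h
    · exact lt_irrefl _ h
    · exact G.group h.2 H₁ H₂ Hx H₁x Hx₂
  rcases composeA_global h₃ with ⟨γ₃, rfl, H₃⟩ | ⟨e, H₃⟩
  · exact ⟨g', i', γ₁, ξ, γ₂, γ₃, rfl, hb', H₁, H₂, H₃, Hx, H₁x, Hx₂, rfl, hne, Or.inl rfl⟩
  · exact ⟨g', i', γ₁, ξ, γ₂, g, rfl, hb', H₁, H₂, H₃, Hx, H₁x, Hx₂, rfl, hne, Or.inr ⟨e, rfl⟩⟩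

theorem before_lt {g g' : C} {i i' : D} {s t : ℕ} (h : Before (inner g i) s (inner g' i') t)
    (hne : g' ≠ g) : g' < g := by
  rcases inner_le_inner.1 h.le with h | h
  · exact h
  · exact absurd h.1 hne

/-- A live column of the outer system whose copy lies between ones of a row from the outer system
lies between them in the outer system. -/
theorem between_of_inner {g h γ₂ γ₃ : C} {i j : D} {s : ℕ} {c₃ : C ×ₗ WithBot D}
    (h₂ : G.A g s γ₂) (hc₃ : c₃ = outer D γ₃ ∨ (c₃ = inner g i ∧ γ₃ = g)) (hh : h ∈ G.live)
    (hne : h ≠ g) (hy₂ : outer D γ₂ < inner h j) (hy₃ : inner h j < c₃) : γ₂ < h ∧ h < γ₃ := by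
  refine ⟨(outer_lt_inner.1 hy₂).lt_of_ne ?_, ?_⟩
  -- The copy follows column `h` immediately, so `γ₂ = h` must be excluded: this is the role of
  -- `live_only`.
  · rintro rfl
    exact hne (G.live_only h₂ hh)
  · rcases hc₃ with rfl | ⟨rfl, rfl⟩
    · exact inner_lt_outer.1 hy₃
    · rcases inner_lt_inner.1 hy₃ with h | h
      · exact h
      · exact absurd h.1 hne

theorem compose_gap {r a c₁ x c₂ c₃ : C ×ₗ WithBot D} {s t : ℕ} {h : C} {i₀ : D}
    (hb : Before r s a t) (h₁ : composeA L G r s c₁) (h₂ : composeA L G r s c₂)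
    (h₃ : composeA L G r s c₃) (hx : composeA L G a t x) (hh : h ∈ G.live) (hi₀ : i₀ ∈ L.live)
    (hha : inner h i₀ ≤ a) (h₁x : c₁ < x) (hx₂ : x < c₂) (h₂h : c₂ < inner h i₀)
    (hh₃ : inner h i₀ < c₃) : False := by
  obtain ⟨g, i, rfl, -⟩ := id h₁
  rcases (composeA_inner h₁).2.2 with ⟨hs, -⟩ | ⟨rfl, -⟩
  · obtain ⟨j₁, rfl, H₁⟩ := composeA_local h₁ hs
    obtain ⟨j₂, rfl, H₂⟩ := composeA_local h₂ hs
    obtain ⟨j₃, rfl, H₃⟩ := composeA_local h₃ hs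
    obtain ⟨jx, rfl, H₁x, Hx₂⟩ := eq_inner_of_between h₁x hx₂
    obtain ⟨_, e, H₂h, Hh₃⟩ := eq_inner_of_between h₂h hh₃
    obtain ⟨rfl, rfl⟩ := inner_inj.1 e
    obtain ⟨g', i', rfl, -⟩ := id hx
    rcases (composeA_inner hx).2.2 with ⟨ht, -⟩ | ⟨rfl, -⟩
    · obtain ⟨_, e, Hx⟩ := composeA_local hx ht
      obtain ⟨rfl, rfl⟩ := inner_inj.1 e
      have hha : i₀ ≤ i' := by
        rcases inner_le_inner.1 hha with h | h
        · exact absurd h (lt_irrefl _)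
        · exact h.2
      exact L.gap (before_local hb) H₁ H₂ H₃ Hx hi₀ hha H₁x Hx₂ H₂h Hh₃
    · rcases composeA_global hx with ⟨c, e, -⟩ | ⟨e, -⟩
      · exact inner_ne_outer e
      · rw [← e] at hha
        rcases inner_le_inner.1 hha with h | h
        · exact lt_irrefl _ h
        · exact (Hx₂.trans H₂h).not_ge h.2
  · obtain ⟨g', i', γ₁, ξ, γ₂, γ₃, rfl, hb', H₁, H₂, H₃, Hx, H₁x, Hx₂, rfl, hne, hc₃⟩ :=
      compose_global hb h₁ h₂ h₃ hx hha h₁x hx₂ h₂h hh₃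
    have hhg' : h ≤ g' := by
      rcases inner_le_inner.1 hha with h | h
      · exact h.le
      · exact h.1.le
    have hhg := hhg'.trans_lt (before_lt hb hne)
    obtain ⟨H₂h, Hh₃⟩ := between_of_inner H₂ hc₃ hh hhg.ne h₂h hh₃
    exact G.gap hb' H₁ H₂ H₃ Hx hh hhg' H₁x Hx₂ H₂h Hh₃

/-- If the top row is local, everything happens in one copy: `L.spread` applies when `y` is in a
local row, `L.gap` when `y` is an added one. If it comes from `G`, then so do `x` and its row;
`G.spread` applies when `y` is in an outer column, and `G.gap`, with the live column whose copy
contains `y`, otherwise. -/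
theorem compose_spread {r a b c₁ x c₂ y c₃ : C ×ₗ WithBot D} {s t u : ℕ}
    (hra : Before r s a t) (hab : Before a t b u ∨ (b = a ∧ u = t)) (h₁ : composeA L G r s c₁)
    (h₂ : composeA L G r s c₂) (h₃ : composeA L G r s c₃) (hx : composeA L G a t x)
    (hy : composeA L G b u y) (h₁x : c₁ < x) (hx₂ : x < c₂) (h₂y : c₂ < y) (hy₃ : y < c₃) :
    False := by
  have hba : b ≤ a := by
    rcases hab with h | h
    · exact h.le
    · exact h.1.le
  have hya : y ≤ a := (composeA_le hy).trans hba
  obtain ⟨g, i, rfl, -⟩ := id h₁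
  obtain ⟨g', i', rfl, -⟩ := id hx
  obtain ⟨g'', i'', rfl, hg'', hi'', -⟩ := id hy
  rcases (composeA_inner h₁).2.2 with ⟨hs, -⟩ | ⟨rfl, -⟩
  · obtain ⟨j₁, rfl, H₁⟩ := composeA_local h₁ hs
    obtain ⟨j₂, rfl, H₂⟩ := composeA_local h₂ hs
    obtain ⟨j₃, rfl, H₃⟩ := composeA_local h₃ hs
    obtain ⟨jx, rfl, H₁x, Hx₂⟩ := eq_inner_of_between h₁x hx₂
    obtain ⟨jy, rfl, H₂y, Hy₃⟩ := eq_inner_of_between h₂y hy₃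
    rcases (composeA_inner hx).2.2 with ⟨ht, -⟩ | ⟨rfl, -⟩
    · obtain ⟨_, e, Hx⟩ := composeA_local hx ht
      obtain ⟨rfl, rfl⟩ := inner_inj.1 e
      rcases (composeA_inner hy).2.2 with ⟨hu, -⟩ | ⟨rfl, -⟩
      · obtain ⟨_, e, Hy⟩ := composeA_local hy hu
        obtain ⟨rfl, rfl⟩ := inner_inj.1 e
        refine L.spread (before_local hra) ?_ H₁ H₂ H₃ Hx Hy H₁x Hx₂ H₂y Hy₃
        exact hab.imp before_local fun h => ⟨(inner_inj.1 h.1).2, h.2⟩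
      · rcases composeA_global hy with ⟨c, e, -⟩ | ⟨e, -⟩
        · exact inner_ne_outer e
        · obtain ⟨rfl, rfl⟩ := inner_inj.1 e
          have : jy ≤ i' := by
            rcases inner_le_inner.1 hya with h | h
            · exact absurd h (lt_irrefl _)
            · exact h.2
          exact L.gap (before_local hra) H₁ H₂ H₃ Hx hi'' this H₁x Hx₂ H₂y Hy₃
    · rcases composeA_global hx with ⟨c, e, -⟩ | ⟨e, -⟩
      · exact inner_ne_outer e
      · rw [← e] at hya
        rcases inner_le_inner.1 hya with h | h
        · exact lt_irrefl _ h
        · exact (Hx₂.trans H₂y).not_ge h.2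
  · obtain ⟨_, _, γ₁, ξ, γ₂, γ₃, e, hb', H₁, H₂, H₃, Hx, H₁x, Hx₂, rfl, hne, hc₃⟩ :=
      compose_global hra h₁ h₂ h₃ hx hya h₁x hx₂ h₂y hy₃
    obtain ⟨rfl, rfl⟩ := inner_inj.1 e
    have hg'g : g'' ≤ g' := by
      rcases inner_le_inner.1 hba with h | h
      · exact h.le
      · exact h.1.le
    have hlt := hg'g.trans_lt (before_lt hra hne)
    rcases (composeA_inner hy).2.2 with ⟨hu, -⟩ | ⟨rfl, -⟩
    · obtain ⟨j, rfl, -⟩ := composeA_local hy hu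
      obtain ⟨H₂y, Hy₃⟩ := between_of_inner H₂ hc₃ hg'' hlt.ne h₂y hy₃
      exact G.gap hb' H₁ H₂ H₃ Hx hg'' hg'g H₁x Hx₂ H₂y Hy₃
    · have htm : t = u := by
        rcases (composeA_inner hx).2.2 with ⟨ht, -⟩ | h
        · obtain ⟨j, rfl, -⟩ := composeA_local hx ht
          exact absurd (inner_lt_outer.1 hx₂) (outer_lt_inner.1 (h₂y.trans_le hya)).not_gt
        · exact h.1
      subst htm
      rcases composeA_global hy with ⟨η, rfl, Hy⟩ | ⟨rfl, -⟩
      · have hη : η < γ₃ := by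
          rcases hc₃ with rfl | ⟨-, rfl⟩
          · exact outer_lt_outer.1 hy₃
          · exact (G.le_lead Hy).trans_lt hlt
        refine G.spread hb' ?_ H₁ H₂ H₃ Hx Hy H₁x Hx₂ (outer_lt_outer.1 h₂y) hη
        rcases hab with h | h
        · exact Or.inl (before_global (composeA_inner hx).2.1 h)
        · obtain ⟨rfl, rfl⟩ := inner_inj.1 h.1
          exact Or.inr ⟨rfl, rfl⟩
      · obtain ⟨H₂y, Hy₃⟩ := between_of_inner H₂ hc₃ hg'' hlt.ne h₂y hy₃
        exact G.gap hb' H₁ H₂ H₃ Hx hg'' hg'g H₁x Hx₂ H₂y Hy₃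

theorem compose_degree {g : C} {i : D} {s : ℕ} (hg : g ∈ G.live) (hi : i ∈ L.live)
    (hs : s < m + 1) :
    ∃ F : Finset (C ×ₗ WithBot D), k + 1 ≤ F.card ∧ ∀ c ∈ F, composeA L G (inner g i) s c := by
  classical
  rcases (Nat.lt_succ_iff.1 hs).lt_or_eq with hs | rfl
  · obtain ⟨F, hF, h⟩ := L.degree hi hs
    refine ⟨F.image (inner g), ?_, ?_⟩
    · rwa [Finset.card_image_of_injective _ fun _ _ h => (inner_inj.1 h).2]
    · simp only [Finset.mem_image, forall_exists_index, and_imp, forall_apply_eq_imp_iff₂]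
      exact fun j hj => ⟨g, i, rfl, hg, hi, Or.inl ⟨j, rfl, h j hj⟩⟩
  · obtain ⟨F, hF, h⟩ := G.degree hg (L.rank_lt_card hi)
    refine ⟨insert (inner g i) (F.image (outer D)), ?_, ?_⟩
    · rw [Finset.card_insert_of_notMem, Finset.card_image_of_injective _ fun _ _ => outer_inj.1]
      · omega
      · simp only [Finset.mem_image, not_exists, not_and]
        exact fun _ _ => outer_ne_inner
    · simp only [Finset.mem_insert, Finset.mem_image, forall_eq_or_imp, forall_exists_index,
        and_imp, forall_apply_eq_imp_iff₂]
      exact ⟨⟨g, i, rfl, hg, hi, Or.inr ⟨rfl, Or.inr rfl⟩⟩, fun c hc =>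
        ⟨g, i, rfl, hg, hi, Or.inr ⟨rfl, Or.inl ⟨c, rfl, h c hc⟩⟩⟩⟩

variable (L G) in
/-- The composite system: a copy of `L` is inserted to the right of each live column `g` of `G`,
and the rows of `G` in the group of `g` get an additional one in the live columns of the copy. -/
def compose : LiveSystem (C ×ₗ WithBot D) (k + 1) (m + 1) where
  cols := G.cols.map ⟨outer D, fun _ _ => outer_inj.1⟩ ∪
    (G.live ×ˢ L.cols).map ⟨fun p => inner p.1 p.2, fun _ _ h => Prod.ext_iff.2 (inner_inj.1 h)⟩
  live :=
    (G.live ×ˢ L.live).map ⟨fun p => inner p.1 p.2, fun _ _ h => Prod.ext_iff.2 (inner_inj.1 h)⟩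
  A := composeA L G
  mem_live := by
    rintro _ s c ⟨g, i, rfl, hg, hi, -⟩
    simp only [Finset.mem_map, Finset.mem_product, Prod.exists]
    exact ⟨g, i, ⟨hg, hi⟩, rfl⟩
  lt_size := by
    rintro _ s c ⟨g, i, rfl, hg, hi, ⟨j, -, h⟩ | h⟩
    · exact (L.lt_size h).trans m.lt_succ_self
    · omega
  mem_cols := by
    rintro _ s c ⟨g, i, rfl, hg, hi, h⟩
    simp only [Finset.mem_union, Finset.mem_map, Finset.mem_product,
      Prod.exists]
    rcases h with ⟨j, rfl, h⟩ | ⟨-, ⟨c₀, rfl, h⟩ | rfl⟩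
    · exact Or.inr ⟨g, j, ⟨hg, L.mem_cols h⟩, rfl⟩
    · exact Or.inl ⟨c₀, G.mem_cols h, rfl⟩
    · exact Or.inr ⟨g, i, ⟨hg, L.live_subset hi⟩, rfl⟩
  lead := by
    intro ℓ s hℓ hs
    simp only [Finset.mem_map, Finset.mem_product, Prod.exists] at hℓ
    obtain ⟨g, i, ⟨hg, hi⟩, rfl⟩ := hℓ
    refine ⟨g, i, rfl, hg, hi, ?_⟩
    rcases (Nat.lt_succ_iff.1 hs).lt_or_eq with hs | rfl
    · exact Or.inl ⟨i, rfl, L.lead hi hs⟩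
    · exact Or.inr ⟨rfl, Or.inr rfl⟩
  le_lead := composeA_le
  live_subset := by
    intro ℓ hℓ
    simp only [Finset.mem_union, Finset.mem_map, Finset.mem_product,
      Prod.exists] at hℓ ⊢
    obtain ⟨g, i, ⟨hg, hi⟩, rfl⟩ := hℓ
    exact Or.inr ⟨g, i, ⟨hg, L.live_subset hi⟩, rfl⟩
  live_only := by
    intro ℓ s h hA hh
    simp only [Finset.mem_map, Finset.mem_product, Prod.exists] at hh
    obtain ⟨g, i, ⟨hg, hi⟩, rfl⟩ := hh
    exact compose_live_only hA hi
  group := compose_group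
  gap := by
    intro r s a t c₁ x c₂ h c₃ hb h₁ h₂ h₃ hx hh
    simp only [Finset.mem_map, Finset.mem_product, Prod.exists] at hh
    obtain ⟨g, i, ⟨hg, hi⟩, rfl⟩ := hh
    exact compose_gap hb h₁ h₂ h₃ hx hg hi
  spread := compose_spread
  degree := by
    intro ℓ s hℓ hs
    simp only [Finset.mem_map, Finset.mem_product, Prod.exists] at hℓ
    obtain ⟨g, i, ⟨hg, hi⟩, rfl⟩ := hℓ
    exact compose_degree hg hi hs

/-! ### Counting columns -/

theorem card_cols_compose :
    (compose L G).cols.card ≤ G.cols.card + G.live.card * L.cols.card := by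
  refine (Finset.card_union_le _ _).trans ?_
  simp

theorem card_live_compose : (compose L G).live.card = G.live.card * L.live.card := by
  simp [compose]

end compose

/-- Composition adds to the ratio of columns to live columns of `L` at most the ratio of `G` divided
by `L.live.card`. Taking `G` from the induction on `k` with `2 * d` makes this at most 1 / (2d), so
the ratio is at most 1 + m / (2d), which is at most m / d once m ≥ 2d. -/
theorem exists_liveSystem (k : ℕ) : ∀ d : ℕ, ∃ m₀ : ℕ, ∀ m, m₀ ≤ m →
    ∃ (C : Type) (_ : LinearOrder C) (S : LiveSystem C (k + 1) m),
      0 < S.live.card ∧ d * S.cols.card ≤ m * S.live.card := by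
  induction k with
  | zero => exact fun d => ⟨d, fun m hm => ⟨ℕ, inferInstance, single m, by simp [single],
      by simpa [single] using hm⟩⟩
  | succ k ih =>
    intro d
    obtain ⟨N, hN⟩ := ih (2 * d)
    have key : ∀ m, ∃ (C : Type) (_ : LinearOrder C) (S : LiveSystem C (k + 2) m),
        0 < S.live.card ∧ N ≤ S.live.card ∧
          2 * d * S.cols.card ≤ (m + 2 * d) * S.live.card := by
      intro m
      induction m with
      -- All columns are live, so the ratio starts at 1; having at least `N` of them lets `hN`
      -- supply the outer system.
      | zero => exact ⟨ℕ, inferInstance, empty _ (N + 1), by simp [empty], by simp [empty],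
          by simp [empty]⟩
      | succ m ihm =>
        obtain ⟨D, _, L, hL₀, hL, hLc⟩ := ihm
        obtain ⟨C, _, G, hG, hGc⟩ := hN _ hL
        refine ⟨_, inferInstance, compose L G, ?_, ?_, ?_⟩
        · rw [card_live_compose]
          exact Nat.mul_pos hG hL₀
        · rw [card_live_compose]
          exact hL.trans (Nat.le_mul_of_pos_left _ hG)
        · rw [card_live_compose]
          calc 2 * d * (compose L G).cols.card
              ≤ 2 * d * (G.cols.card + G.live.card * L.cols.card) :=
                Nat.mul_le_mul_left _ card_cols_compose
            _ = 2 * d * G.cols.card + G.live.card * (2 * d * L.cols.card) := by ring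
            _ ≤ L.live.card * G.live.card + G.live.card * ((m + 2 * d) * L.live.card) :=
                Nat.add_le_add hGc (Nat.mul_le_mul_left _ hLc)
            _ = (m + 1 + 2 * d) * (G.live.card * L.live.card) := by ring
    refine ⟨2 * d, fun m hm => ?_⟩
    obtain ⟨C, _, S, hS, -, hSc⟩ := key m
    refine ⟨C, _, S, hS, ?_⟩
    have : (m + 2 * d) * S.live.card ≤ 2 * m * S.live.card :=
      Nat.mul_le_mul_right _ (by omega)
    nlinarith

end LiveSystem

/-! ### From live systems to non-linear extremal functions -/

namespace ZeroOneMatrix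

/-- There are no rows `r < a ≤ b` and columns `c₁ < x < c₂ < y < c₃` with ones at
`(r, c₁), (r, c₂), (r, c₃), (a, x), (b, y)`. -/
def SpreadFree {m n : ℕ} (A : ZeroOneMatrix m n) : Prop :=
  ∀ ⦃r a b c₁ x c₂ y c₃⦄, r < a → a ≤ b → c₁ < x → x < c₂ → c₂ < y → y < c₃ →
    A r c₁ = true → A r c₂ = true → A r c₃ = true → A a x = true → A b y = true → False

theorem exists_spreadFree (k : ℕ) : ∃ n, 0 < n ∧ ∃ A : ZeroOneMatrix n n, A.SpreadFree ∧
    ∀ i, k ≤ A.rowOnes i := by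
  classical
  -- With `d = 1` there are at most as many columns as rows, so empty columns complete a square.
  obtain ⟨m₀, h⟩ := LiveSystem.exists_liveSystem k 1
  obtain ⟨m, hm, C, _, S, hpos, hcard⟩ : ∃ m, 0 < m ∧ ∃ (C : Type) (_ : LinearOrder C)
      (S : LiveSystem C (k + 1) m), 0 < S.live.card ∧ 1 * S.cols.card ≤ m * S.live.card :=
    ⟨m₀ + 1, by omega, h (m₀ + 1) (by omega)⟩
  let R : Finset (Cᵒᵈ ×ₗ ℕ) := (S.live ×ˢ Finset.range m).map
    ⟨fun p => toLex (OrderDual.toDual p.1, p.2), fun p q h => by simpa [Prod.ext_iff] using h⟩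
  have hR : R.card = m * S.live.card := by simp [R, mul_comm]
  let e := R.orderEmbOfFin hR
  let f := S.cols.orderEmbOfFin rfl
  have hw : S.cols.card ≤ m * S.live.card := by omega
  let P : Fin (m * S.live.card) → Fin S.cols.card → Prop := fun i j =>
    S.A (OrderDual.ofDual (ofLex (e i)).1) (ofLex (e i)).2 (f j)
  let A : ZeroOneMatrix (m * S.live.card) (m * S.live.card) := fun i j =>
    decide (∃ j' : Fin S.cols.card, Fin.castLE hw j' = j ∧ P i j')
  have hA : ∀ {i j}, A i j = true → ∃ j', Fin.castLE hw j' = j ∧ P i j' := by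
    intro i j h
    simpa only [A, decide_eq_true_eq] using h
  have hbefore : ∀ {i i'}, i < i' →
      Before (OrderDual.ofDual (ofLex (e i)).1) (ofLex (e i)).2
        (OrderDual.ofDual (ofLex (e i')).1) (ofLex (e i')).2 := by
    intro i i' h
    rcases Prod.Lex.lt_iff.1 (e.lt_iff_lt.2 h) with h | h
    · exact Or.inl h
    · exact Or.inr ⟨(congrArg OrderDual.ofDual h.1).symm, h.2⟩
  refine ⟨m * S.live.card, Nat.mul_pos hm hpos, A, ?_, ?_⟩
  · intro r a b c₁ x c₂ y c₃ hra hab h₁x hx₂ h₂y hy₃ h₁ h₂ h₃ hx hy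
    obtain ⟨c₁, rfl, H₁⟩ := hA h₁
    obtain ⟨c₂, rfl, H₂⟩ := hA h₂
    obtain ⟨c₃, rfl, H₃⟩ := hA h₃
    obtain ⟨x, rfl, Hx⟩ := hA hx
    obtain ⟨y, rfl, Hy⟩ := hA hy
    refine S.spread (hbefore hra) ?_ H₁ H₂ H₃ Hx Hy (f.lt_iff_lt.2 h₁x) (f.lt_iff_lt.2 hx₂)
      (f.lt_iff_lt.2 h₂y) (f.lt_iff_lt.2 hy₃)
    rcases hab.lt_or_eq with h | rfl
    · exact Or.inl (hbefore h)
    · exact Or.inr ⟨rfl, rfl⟩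
  · intro i
    obtain ⟨⟨ℓ, s⟩, hp, he⟩ := Finset.mem_map.1 (R.orderEmbOfFin_mem hR i)
    obtain ⟨hℓ, hs⟩ := Finset.mem_product.1 hp
    replace he : toLex (OrderDual.toDual ℓ, s) = e i := he
    obtain ⟨F, hF, hFA⟩ := S.degree hℓ (Finset.mem_range.1 hs)
    have hP : ∀ j, P i j ↔ S.A ℓ s (f j) := by
      intro j
      simp only [P, ← he]
      rfl
    calc k ≤ F.card := by omega
      _ ≤ ((Finset.univ.filter fun j => P i j).image f).card := by
        refine Finset.card_le_card fun c hc => ?_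
        have hc' : c ∈ Set.range f := by
          rw [Finset.range_orderEmbOfFin]
          exact S.mem_cols (hFA c hc)
        obtain ⟨j, rfl⟩ := hc'
        exact Finset.mem_image_of_mem _ (by simp [hP, hFA _ hc])
      _ ≤ (Finset.univ.filter fun j => P i j).card := Finset.card_image_le
      _ = ((Finset.univ.filter fun j => P i j).map (Fin.castLEEmb hw)).card := by simp
      _ ≤ A.rowOnes i := by
        refine Finset.card_le_card fun j hj => ?_
        obtain ⟨j', hj', rfl⟩ := Finset.mem_map.1 hj
        simp only [Finset.mem_filter, Finset.mem_univ, true_and] at hj' ⊢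
        exact decide_eq_true ⟨j', rfl, hj'⟩

theorem ones_le_ex {k l n : ℕ} {P : ZeroOneMatrix k l} {A : ZeroOneMatrix n n}
    (hA : A.Avoids P) : A.ones ≤ ex n P := by
  classical
  unfold ex
  exact Finset.le_sup (f := ones) (by simpa using hA)

/-- The extremal function is not linear if there are avoiding matrices with arbitrarily many ones
in each row. -/
theorem not_isBigO_ex {k l : ℕ} {P : ZeroOneMatrix k l}
    (h : ∀ K, ∃ n, 0 < n ∧ ∃ A : ZeroOneMatrix n n, A.Avoids P ∧ ∀ i, K ≤ A.rowOnes i) :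
    ¬ (fun n : ℕ => (ex n P : ℝ)) =O[atTop] fun n : ℕ => (n : ℝ) := by
  intro hO
  obtain ⟨c, hc⟩ := hO.bound
  obtain ⟨N, hN⟩ := eventually_atTop.1 hc
  obtain ⟨K, hK⟩ := exists_nat_gt (max c N)
  obtain ⟨n, hn, A, hA, hrow⟩ := h K
  -- A row with `K` ones forces `K ≤ n`, so `K > N` brings `n` into the range of the bound.
  have hKn : K ≤ n := (hrow ⟨0, hn⟩).trans <| (Finset.card_filter_le _ _).trans (by simp)
  have hNK : N ≤ K := by exact_mod_cast ((le_max_right c N).trans hK.le)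
  have h₁ := hN n (hNK.trans hKn)
  simp only [Real.norm_natCast] at h₁
  have h₂ : n * K ≤ A.ones := by
    simpa [ones] using Finset.card_nsmul_le_sum Finset.univ A.rowOnes K fun i _ => hrow i
  have h₃ : (n : ℝ) * K ≤ ex n P := by exact_mod_cast h₂.trans (ones_le_ex hA)
  have hn' : (0 : ℝ) < n := by exact_mod_cast hn
  have h₄ : c < K := (le_max_left c N).trans_lt hK
  nlinarith

theorem rowOnes_submatrix {k n l : ℕ} (A : ZeroOneMatrix n l) (f : Fin k → Fin n)
    (g : Fin l ≃ Fin l) (i : Fin k) : rowOnes (A.submatrix f g) i = A.rowOnes (f i) := by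
  refine Finset.card_bij (fun j _ => g j) (fun j hj => ?_) (fun _ _ _ _ h => g.injective h)
    fun j hj => ⟨g.symm j, ?_, by simp⟩
  · exact Finset.mem_filter.2 ⟨Finset.mem_univ _, (Finset.mem_filter.1 hj).2⟩
  · exact Finset.mem_filter.2 ⟨Finset.mem_univ _, by simpa using (Finset.mem_filter.1 hj).2⟩

/-! ### Ones on the same side of a row -/

/-- The matrix whose ones are those of a configuration as in `SpreadFree`. -/
def spreadPattern {h w : ℕ} (r a b : Fin h) (c₁ x c₂ y c₃ : Fin w) : ZeroOneMatrix h w :=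
  fun i j => decide ((i = r ∧ (j = c₁ ∨ j = c₂ ∨ j = c₃)) ∨ (i = a ∧ j = x) ∨ (i = b ∧ j = y))

/-- A matrix with a configuration as in `SpreadFree`, or one of its reflections, has a strict
subpattern that is not linear if its top row has at least four ones. -/
theorem MinimallyNonlinear.not_spread {h w : ℕ} {M : ZeroOneMatrix h w}
    (hM : M.MinimallyNonlinear) {r a b : Fin h} {c₁ x c₂ y c₃ : Fin w}
    (hrow : 3 < M.rowOnes r) (har : a ≠ r) (hbr : b ≠ r)
    (h₁ : M r c₁ = true) (h₂ : M r c₂ = true) (h₃ : M r c₃ = true) (hx : M a x = true)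
    (hy : M b y = true)
    (hfree : ∀ {n : ℕ} (A : ZeroOneMatrix n n), A.SpreadFree → ∃ B : ZeroOneMatrix n n,
      B.Avoids (spreadPattern r a b c₁ x c₂ y c₃) ∧ ∀ k, (∀ i, k ≤ A.rowOnes i) →
        ∀ i, k ≤ B.rowOnes i) : False := by
  classical
  refine not_isBigO_ex (P := spreadPattern r a b c₁ x c₂ y c₃) (fun K => ?_)
    (hM.2 _ _ _ ?_ ?_)
  · obtain ⟨n, hn, A, hA, hK⟩ := exists_spreadFree K
    obtain ⟨B, hB, hBK⟩ := hfree A hA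
    exact ⟨n, hn, B, hB, hBK K hK⟩
  · refine ⟨id, id, strictMono_id, strictMono_id, fun i j hij => ?_⟩
    simp only [spreadPattern, decide_eq_true_eq] at hij
    rcases hij with ⟨rfl, rfl | rfl | rfl⟩ | ⟨rfl, rfl⟩ | ⟨rfl, rfl⟩ <;> assumption
  · intro e
    simp only [Sigma.mk.injEq, heq_eq_eq, true_and] at e
    rw [← e] at hrow
    refine absurd hrow (not_lt.2 ?_)
    calc rowOnes (spreadPattern r a b c₁ x c₂ y c₃) r ≤ ({c₁, c₂, c₃} : Finset (Fin w)).card := by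
          refine Finset.card_le_card fun j hj => ?_
          simpa [spreadPattern, har.symm, hbr.symm] using hj
      _ ≤ 3 := Finset.card_le_three

theorem exists_of_contains_spreadPattern {h w m n : ℕ} {A : ZeroOneMatrix m n}
    {r a b : Fin h} {c₁ x c₂ y c₃ : Fin w}
    (hA : A.Contains (spreadPattern r a b c₁ x c₂ y c₃)) :
    ∃ (f : Fin h → Fin m) (g : Fin w → Fin n), StrictMono f ∧ StrictMono g ∧
      A (f r) (g c₁) = true ∧ A (f r) (g c₂) = true ∧ A (f r) (g c₃) = true ∧
      A (f a) (g x) = true ∧ A (f b) (g y) = true := by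
  obtain ⟨f, g, hf, hg, H⟩ := hA
  exact ⟨f, g, hf, hg, H _ _ (by simp [spreadPattern]), H _ _ (by simp [spreadPattern]),
    H _ _ (by simp [spreadPattern]), H _ _ (by simp [spreadPattern]),
    H _ _ (by simp [spreadPattern])⟩

/-- A row with four ones of a minimally non-linear matrix does not have two ones in other rows, both
below or both above it, that are separated and surrounded by its ones. -/
theorem MinimallyNonlinear.lt_iff_lt {h w : ℕ} {M : ZeroOneMatrix h w}
    (hM : M.MinimallyNonlinear) {r a b : Fin h} {c₁ x c₂ y c₃ : Fin w}
    (hrow : 3 < M.rowOnes r) (har : a ≠ r) (hbr : b ≠ r)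
    (h₁ : M r c₁ = true) (h₂ : M r c₂ = true) (h₃ : M r c₃ = true) (hx : M a x = true)
    (hy : M b y = true) (h₁x : c₁ < x) (hx₂ : x < c₂) (h₂y : c₂ < y) (hy₃ : y < c₃) :
    r < a ↔ b < r := by
  by_contra hcon
  refine hM.not_spread hrow har hbr h₁ h₂ h₃ hx hy fun {n} A hA => ?_
  have hside : (r < a ∧ r < b) ∨ (a < r ∧ b < r) := by omega
  -- `SpreadFree` wants row `r` on top and the left one of the other two not lower than the right
  -- one; reflections reduce the other cases to this.
  rcases hside with ⟨hra, hrb⟩ | ⟨hra, hrb⟩ <;> rcases le_total a b with hab | hab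
  · refine ⟨A, fun hc => ?_, fun k hk => hk⟩
    obtain ⟨f, g, hf, hg, H₁, H₂, H₃, Hx, Hy⟩ := exists_of_contains_spreadPattern hc
    exact hA (hf hra) (hf.monotone hab) (hg h₁x) (hg hx₂) (hg h₂y) (hg hy₃) H₁ H₂ H₃ Hx Hy
  · refine ⟨A.submatrix id Fin.revPerm, fun hc => ?_, fun k hk i => ?_⟩
    · obtain ⟨f, g, hf, hg, H₁, H₂, H₃, Hx, Hy⟩ := exists_of_contains_spreadPattern hc
      exact hA (hf hrb) (hf.monotone hab) (Fin.rev_lt_rev.2 (hg hy₃)) (Fin.rev_lt_rev.2 (hg h₂y))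
        (Fin.rev_lt_rev.2 (hg hx₂)) (Fin.rev_lt_rev.2 (hg h₁x)) H₃ H₂ H₁ Hy Hx
    · exact (hk _).trans_eq (rowOnes_submatrix A _ _ i).symm
  · refine ⟨A.submatrix Fin.rev Fin.revPerm, fun hc => ?_, fun k hk i => ?_⟩
    · obtain ⟨f, g, hf, hg, H₁, H₂, H₃, Hx, Hy⟩ := exists_of_contains_spreadPattern hc
      exact hA (Fin.rev_lt_rev.2 (hf hrb)) (Fin.rev_le_rev.2 (hf.monotone hab))
        (Fin.rev_lt_rev.2 (hg hy₃)) (Fin.rev_lt_rev.2 (hg h₂y))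
        (Fin.rev_lt_rev.2 (hg hx₂)) (Fin.rev_lt_rev.2 (hg h₁x)) H₃ H₂ H₁ Hy Hx
    · exact (hk _).trans_eq (rowOnes_submatrix A _ _ i).symm
  · refine ⟨A.submatrix Fin.rev (Equiv.refl _), fun hc => ?_, fun k hk i => ?_⟩
    · obtain ⟨f, g, hf, hg, H₁, H₂, H₃, Hx, Hy⟩ := exists_of_contains_spreadPattern hc
      exact hA (Fin.rev_lt_rev.2 (hf hra)) (Fin.rev_le_rev.2 (hf.monotone hab))
        (hg h₁x) (hg hx₂) (hg h₂y) (hg hy₃) H₁ H₂ H₃ Hx Hy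
    · exact (hk _).trans_eq (rowOnes_submatrix A _ _ i).symm


/-! ### Deleting ones by thinning -/

/-- In each row one can keep at least every `t`-th one, so that between any two ones that are kept
there are `t - 1` others. -/
theorem exists_thinning {m n : ℕ} (A : ZeroOneMatrix m n) {t : ℕ} (ht : 0 < t) :
    ∃ B : ZeroOneMatrix m n, A.ones ≤ t * B.ones ∧ (∀ i j, B i j = true → A i j = true) ∧
      ∀ i j j', j < j' → B i j = true → B i j' = true →
        t ≤ ((Finset.Ioo j j').filter fun l => A i l = true).card + 1 := by
  classical
  let S : Fin m → Finset (Fin n) := fun i => Finset.univ.filter fun j => A i j = true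
  let p : Fin m → Fin n → ℕ := fun i j => ((S i).filter (· < j)).card
  -- Pigeonhole: some residue class mod `t` of the positions of the ones in a row holds at least a
  -- 1/t share of them.
  have hρ : ∀ i, ∃ ρ, (S i).card ≤ t * ((S i).filter fun j => p i j % t = ρ).card := by
    intro i
    have hmaps : ∀ j ∈ S i, p i j % t ∈ Finset.range t := fun j _ =>
      Finset.mem_range.2 (Nat.mod_lt _ ht)
    by_contra! h
    have h₁ := Finset.card_eq_sum_card_fiberwise hmaps
    have h₂ : ∑ ρ ∈ Finset.range t, t * ((S i).filter fun j => p i j % t = ρ).card <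
        ∑ ρ ∈ Finset.range t, (S i).card :=
      Finset.sum_lt_sum_of_nonempty ⟨0, by simpa using ht⟩ fun ρ _ => h ρ
    rw [← Finset.mul_sum, ← h₁] at h₂
    simp at h₂
  choose ρ hρ using hρ
  refine ⟨fun i j => decide (A i j = true ∧ p i j % t = ρ i), ?_,
    fun i j h => (of_decide_eq_true h).1, ?_⟩
  · unfold ones
    rw [Finset.mul_sum]
    refine Finset.sum_le_sum fun i _ => (hρ i).trans_eq ?_
    simp only [rowOnes, S, Finset.filter_filter, decide_eq_true_eq]
  · intro i j j' hjj' hj hj'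
    simp only [decide_eq_true_eq] at hj hj'
    have hsplit : (S i).filter (· < j') =
        (S i).filter (· < j) ∪ insert j ((Finset.Ioo j j').filter fun l => A i l = true) := by
      ext l
      simp only [S, Finset.mem_filter, Finset.mem_univ, true_and, Finset.mem_union,
        Finset.mem_insert, Finset.mem_Ioo]
      constructor
      · rintro ⟨hl, hlj⟩
        rcases lt_trichotomy l j with h | h | h <;> simp [*]
      · rintro (⟨hl, hlj⟩ | rfl | ⟨⟨_, hlj⟩, hl⟩)
        · exact ⟨hl, hlj.trans hjj'⟩
        · exact ⟨hj.1, hjj'⟩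
        · exact ⟨hl, hlj⟩
    have hcard : p i j' =
        p i j + (((Finset.Ioo j j').filter fun l => A i l = true).card + 1) := by
      simp only [p]
      rw [hsplit, Finset.card_union_of_disjoint, Finset.card_insert_of_notMem (by simp)]
      refine Finset.disjoint_left.2 fun l hl hl' => ?_
      simp only [Finset.mem_filter, Finset.mem_insert, Finset.mem_Ioo] at hl hl'
      rcases hl' with rfl | hl'
      · exact lt_irrefl _ hl.2
      · exact lt_asymm hl.2 hl'.1.1
    have hmod : p i j' ≡ p i j [MOD t] := hj'.2.trans hj.2.symm
    have hdvd := (Nat.modEq_iff_dvd' (by omega : p i j ≤ p i j')).1 hmod.symm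
    rw [hcard, Nat.add_sub_cancel_left] at hdvd
    exact Nat.le_of_dvd (Nat.succ_pos _) hdvd

/-- If all columns between two ones of row `r` have ones in row `r` only, then ones of row `r` in
these columns can be deleted without changing the order of magnitude of the extremal function. -/
theorem ex_le_of_between {h w : ℕ} {M M' : ZeroOneMatrix h w} {r : Fin h} {c₁ c₃ : Fin w}
    (hc : c₁ < c₃) (h₁ : M' r c₁ = true) (h₃ : M' r c₃ = true)
    (hbetween : ∀ i j, c₁ < j → j < c₃ → M i j = true → i = r)
    (heq : ∀ i j, ¬ (c₁ < j ∧ j < c₃) → M' i j = M i j) (n : ℕ) :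
    ex n M ≤ (c₃ - c₁ : ℕ) * ex n M' := by
  classical
  -- With t = c₃ - c₁, kept ones have at least t - 1 ones of `A` between them, enough to host all
  -- columns strictly between `c₁` and `c₃`.
  have ht : 0 < (c₃ - c₁ : ℕ) := Nat.sub_pos_of_lt hc
  conv_lhs => unfold ex
  refine Finset.sup_le fun A hA => ?_
  simp only [Finset.mem_filter, Finset.mem_univ, true_and] at hA
  obtain ⟨B, hB, hBA, hgap⟩ := A.exists_thinning ht
  refine hB.trans (Nat.mul_le_mul_left _ (ones_le_ex ?_))
  rintro ⟨f, g, hf, hg, H⟩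
  have hcard := hgap _ _ _ (hg hc) (H _ _ h₁) (H _ _ h₃)
  set T := (Finset.Ioo (g c₁) (g c₃)).filter fun l => A (f r) l = true
  have hT : (c₃ - c₁ - 1 : ℕ) ≤ T.card := by omega
  let φ := T.orderEmbOfCardLe hT
  have hφ : ∀ i, (g c₁ < φ i ∧ φ i < g c₃) ∧ A (f r) (φ i) = true := fun i => by
    simpa [T] using T.orderEmbOfCardLe_mem hT i
  let g' : Fin w → Fin n := fun j =>
    if hj : c₁ < j ∧ j < c₃ then φ ⟨j - c₁ - 1, by have := hj.1; have := hj.2; omega⟩ else g j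
  refine hA ⟨f, g', hf, fun j j' hjj' => ?_, fun i j hij => ?_⟩
  · simp only [g']
    split_ifs with hj hj' hj'
    · refine φ.lt_iff_lt.2 ?_
      simp only [Fin.mk_lt_mk]
      have := hj.1
      omega
    · exact (hφ _).1.2.trans_le (hg.monotone (by have := hj.1; omega))
    · exact (hg.monotone (by have := hj'.2; omega)).trans_lt (hφ _).1.1
    · exact hg hjj'
  · simp only [g']
    split_ifs with hj
    · obtain rfl := hbetween i j hj.1 hj.2 hij
      exact (hφ _).2
    · exact hBA _ _ (H _ _ ((heq i j hj).trans hij))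

/-- Between two ones of a row of a minimally non-linear matrix that are not consecutive there is a
column with a one in another row. -/
theorem MinimallyNonlinear.exists_between {h w : ℕ} {M : ZeroOneMatrix h w}
    (hM : M.MinimallyNonlinear) {r : Fin h} {c₁ c₂ c₃ : Fin w} (h₁ : M r c₁ = true)
    (h₂ : M r c₂ = true) (h₃ : M r c₃ = true) (h₁₂ : c₁ < c₂) (h₂₃ : c₂ < c₃) :
    ∃ a x, a ≠ r ∧ c₁ < x ∧ x < c₃ ∧ M a x = true := by
  by_contra! hcon
  let M' : ZeroOneMatrix h w := fun i j => M i j && decide (¬ (i = r ∧ j = c₂))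
  have hlin := hM.2 h w M' ⟨id, id, strictMono_id, strictMono_id, fun i j hij =>
    (Bool.and_eq_true _ _ ▸ hij).1⟩ fun e => by
      simp only [Sigma.mk.injEq, heq_eq_eq, true_and] at e
      rw [← e] at h₂
      simp [M'] at h₂
  have hle := ex_le_of_between (M := M) (M' := M') (r := r) (h₁₂.trans h₂₃)
    (by simp [M', h₁, h₁₂.ne]) (by simp [M', h₃, h₂₃.ne'])
    (fun i j hj hj' hij => by
      by_contra hi
      exact hcon i j hi hj hj' hij)
    (fun i j hj => by
      have : ¬ (i = r ∧ j = c₂) := fun hij => hj (hij.2 ▸ ⟨h₁₂, h₂₃⟩)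
      show (M i j && decide (¬ (i = r ∧ j = c₂))) = M i j
      rw [decide_eq_true this, Bool.and_true])
  have hO : (fun n : ℕ => (ex n M : ℝ)) =O[atTop] fun n : ℕ => (n : ℝ) := by
    refine (IsBigO.of_bound (c₃ - c₁ : ℕ) (Eventually.of_forall fun n => ?_)).trans hlin
    simp only [Real.norm_natCast]
    exact_mod_cast hle n
  exact hM.1.not_isBigO ((eventually_gt_atTop 0).frequently.mono fun n hn => by
    exact_mod_cast hn.ne') hO

end ZeroOneMatrix

theorem mainTheorem6 {h w : ℕ} (M : ZeroOneMatrix h w) (hM : M.MinimallyNonlinear)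
    (r : Fin h) : M.rowOnes r ≤ 6 := by
  by_contra! hr
  let c := (Finset.univ.filter fun j => M r j = true).orderEmbOfCardLe (k := 7) hr
  have hc : ∀ i, M r (c i) = true := fun i => by
    simpa using Finset.orderEmbOfCardLe_mem _ hr i
  have hlt : ∀ {i j : Fin 7}, i < j → c i < c j := fun h => c.lt_iff_lt.2 h
  -- Three intervals sharing only end columns need seven ones.
  obtain ⟨a₁, x₁, ha₁, hl₁, hr₁, h₁⟩ := hM.exists_between (hc 0) (hc 1) (hc 2)
    (hlt (by decide)) (hlt (by decide))
  obtain ⟨a₂, x₂, ha₂, hl₂, hr₂, h₂⟩ := hM.exists_between (hc 2) (hc 3) (hc 4)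
    (hlt (by decide)) (hlt (by decide))
  obtain ⟨a₃, x₃, ha₃, hl₃, hr₃, h₃⟩ := hM.exists_between (hc 4) (hc 5) (hc 6)
    (hlt (by decide)) (hlt (by decide))
  have h24 : c 2 < c 4 := hlt (by decide)
  have h₁₂ := hM.lt_iff_lt (by omega) ha₁ ha₂ (hc 0) (hc 2) (hc 4) h₁ h₂ hl₁ hr₁ hl₂ hr₂
  have h₁₃ := hM.lt_iff_lt (by omega) ha₁ ha₃ (hc 0) (hc 2) (hc 6) h₁ h₃ hl₁ hr₁ (h24.trans hl₃) hr₃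
  have h₂₃ := hM.lt_iff_lt (by omega) ha₂ ha₃ (hc 2) (hc 4) (hc 6) h₂ h₃ hl₂ hr₂ hl₃ hr₃
  -- Three rows cannot lie pairwise on opposite sides of `r`.
  omega
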